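/- A (complete deterministic finite) automaton $\mathcal A=\langle Q,\Sigma\rangle$ consists of a finite non-empty set $Q$ of states, a finite input alphabet $\Sigma$, and for each letter $a\in\Sigma$ a map $Q\to Q$, $q\mapsto q\cdot a$; words over $\Sigma$ act on $Q$ letter by letter from left to right, and $Q\cdot w=\{q\cdot w\mid q\in Q\}$. The automaton $\mathcal A$ is completely reachable if every non-empty $P\subseteq Q$ equals $Q\cdot w$ for some word $w$; it is synchronizing if $Q\cdot w$ is a singleton for some word $w$, called a reset word, and its reset threshold is then the minimum length of its reset words. The Černý conjecture holds for completely reachable automata with two input letters: every completely reachable automaton with $n$ states and exactly two input letters is synchronizing and its reset threshold does not exceed $(n-1)^2$. The bound is tight: for each $n>1$, the Černý automaton $\mathcal C_n$, with states $0,1,\dots,n-1$ and input letters $a,b$ acting by $0\cdot a=1$, $i\cdot a=i$ for $i>0$, and $i\cdot b=i+1\pmod n$, is completely reachable (hence synchronizing) and its reset threshold is exactly $(n-1)^2$. -/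

import Mathlib

/-- A complete deterministic automaton `⟨Q, A, δ⟩` with state set `Q`, input alphabet `A` and
totally defined transition function `δ` (no initial or final states). -/
structure Automaton (Q A : Type*) where
  /-- The transition function. -/
  step : Q → A → Q

namespace Automaton

/-- `M.run q w` is the state `q · w` reached from `q` by reading the word `w` from left to
right. -/
def run {Q A : Type*} (M : Automaton Q A) (q : Q) (w : List A) : Q :=
  w.foldl M.step q

/-- `M.image w` is the image `Q · w` of the whole state set under the action of the word `w`. -/
def image {Q A : Type*} (M : Automaton Q A) (w : List A) : Set Q :=
  Set.range fun q => M.run q w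

/-- A set of states is reachable if it is the image of the whole state set under some word. -/
def IsReachable {Q A : Type*} (M : Automaton Q A) (P : Set Q) : Prop :=
  ∃ w : List A, P = M.image w

/-- An automaton is completely reachable if every non-empty set of states is reachable. -/
def CompletelyReachable {Q A : Type*} (M : Automaton Q A) : Prop :=
  ∀ P : Set Q, P.Nonempty → M.IsReachable P

/-- A reset word is a word under which the image of the state set is a singleton. -/
def IsResetWord {Q A : Type*} (M : Automaton Q A) (w : List A) : Prop :=
  ∃ q : Q, M.image w = {q}

/-- An automaton is synchronizing if it has a reset word. -/
def IsSynchronizing {Q A : Type*} (M : Automaton Q A) : Prop :=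
  ∃ w : List A, M.IsResetWord w

/-- The reset threshold of a synchronizing automaton: the minimum length of its reset words.
(It is meaningful only for synchronizing automata.) -/
noncomputable def resetThreshold {Q A : Type*} (M : Automaton Q A) : ℕ :=
  sInf {l : ℕ | ∃ w : List A, M.IsResetWord w ∧ w.length = l}

end Automaton

/-- An alphabet with exactly two letters `a` and `b`. -/
inductive BinaryLetter : Type where
  | a : BinaryLetter
  | b : BinaryLetter

/-- The Černý automaton `C_n` on the states `0, 1, …, n - 1` (residues modulo `n`, for `n > 1`):
the letter `a` sends `0` to `1` and fixes every other state, and the letter `b` sends `i` to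
`i + 1` modulo `n`. -/
def cernyAutomaton (n : ℕ) : Automaton (ZMod n) BinaryLetter where
  step
    | i, .a => if i = 0 then 1 else i
    | i, .b => i + 1

/-! For n ≥ 3, complete reachability forces one letter `b` to be a permutation and the other, `a`,
to miss exactly one state e. A word reaching Q∖{q} ends in `a` and a power b^j with b^j e = q, so
`b` is an n-cycle and Q becomes ℤ/n with `b` acting as x ↦ x + 1.

There, every nonempty proper S has a larger preimage under some word of length ≤ n
(`exists_length_le_ncard_lt`). Let d be the state with two `a`-preimages and G the translation
stabilizer of S. The `a`-preimage of T has |T| + [d ∈ T] − [e ∈ T] elements, so a word a·v·b^k is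
sought whose part v·b^k takes d into S and e out of it. A shortest v sending d and e to different
cosets of G has length ≤ n − [ℤ/n : G], and some k < [ℤ/n : G] then suffices. From the two-element
a⁻¹(d), n − 2 extensions give length n(n − 2) + 1 = (n − 1)².

For the Černý automaton, a reset word makes `a` move some state's trajectory at least n − 1 times,
and consecutive moves are at least n letters apart. -/

namespace Automaton

variable {Q A : Type*}

@[simp]
theorem run_nil (M : Automaton Q A) (q : Q) : M.run q [] = q := rfl

@[simp]
theorem run_cons (M : Automaton Q A) (q : Q) (c : A) (w : List A) :
    M.run q (c :: w) = M.run (M.step q c) w := rfl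

theorem run_append (M : Automaton Q A) (q : Q) (u v : List A) :
    M.run q (u ++ v) = M.run (M.run q u) v := by
  simp [run, List.foldl_append]

theorem image_append (M : Automaton Q A) (u v : List A) :
    M.image (u ++ v) = (fun q => M.run q v) '' M.image u := by
  simp only [image, run_append, ← Set.range_comp, Function.comp_def]

theorem isResetWord_iff [Nonempty Q] (M : Automaton Q A) (w : List A) :
    M.IsResetWord w ↔ ∃ q, ∀ x, M.run x w = q := by
  constructor
  · rintro ⟨q, hq⟩
    exact ⟨q, fun x => by
      have : M.run x w ∈ M.image w := ⟨x, rfl⟩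
      rwa [hq] at this⟩
  · rintro ⟨q, hq⟩
    refine ⟨q, ?_⟩
    simp [image, hq]

theorem resetThreshold_le (M : Automaton Q A) {w : List A} (hw : M.IsResetWord w) :
    M.resetThreshold ≤ w.length :=
  Nat.sInf_le ⟨w, hw, rfl⟩

theorem CompletelyReachable.isSynchronizing [Nonempty Q] {M : Automaton Q A}
    (h : M.CompletelyReachable) : M.IsSynchronizing := by
  obtain ⟨q⟩ := ‹Nonempty Q›
  obtain ⟨w, hw⟩ := h {q} ⟨q, rfl⟩
  exact ⟨w, q, hw.symm⟩

/-! ### Sizes of preimages -/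

/-- If `f` is a bijection from the complement of `p` onto the complement of `e`, then the only
points whose fibre is not a singleton are `e` (empty fibre) and `f p` (two points), when these
differ. -/
theorem ncard_preimage_of_bijOn_compl [Finite Q] {f : Q → Q} {p e : Q}
    (hf : Set.BijOn f {p}ᶜ {e}ᶜ) (T : Set Q) [Decidable (e ∈ T)] [Decidable (f p ∈ T)] :
    (f ⁻¹' T).ncard + (if e ∈ T then 1 else 0) = T.ncard + (if f p ∈ T then 1 else 0) := by
  have key : (f ⁻¹' T \ {p}).ncard = (T \ {e}).ncard := by
    have hB : Set.BijOn f (f ⁻¹' T \ {p}) (T \ {e}) := by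
      refine ⟨fun x hx => ⟨hx.1, hf.mapsTo hx.2⟩, hf.injOn.mono fun x hx => hx.2, ?_⟩
      rintro y ⟨hy, hye⟩
      obtain ⟨x, hx, rfl⟩ := hf.surjOn hye
      exact ⟨x, ⟨hy, hx⟩, rfl⟩
    rw [← hB.image_eq, hB.injOn.ncard_image]
  have h1 : (f ⁻¹' T).ncard = (f ⁻¹' T \ {p}).ncard + (if f p ∈ T then 1 else 0) := by
    split_ifs with h
    · exact (Set.ncard_sdiff_singleton_add_one (s := f ⁻¹' T) h).symm
    · rw [Set.sdiff_singleton_eq_self (s := f ⁻¹' T) h, add_zero]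
  have h2 : T.ncard = (T \ {e}).ncard + (if e ∈ T then 1 else 0) := by
    split_ifs with h
    · exact (Set.ncard_sdiff_singleton_add_one h).symm
    · rw [Set.sdiff_singleton_eq_self h, add_zero]
  omega

/-- Preimages under words keep the size of `T` as long as `T` does not separate the images of the
missing state `e` and the doubled state of the letter `a` under shorter words. -/
theorem ncard_preimage_run [Finite Q] {M : Automaton Q A} {a b : A} (hab : ∀ c, c = a ∨ c = b)
    (hb : Function.Bijective fun x => M.step x b) {p e : Q}
    (ha : Set.BijOn (fun x => M.step x a) {p}ᶜ {e}ᶜ) (T : Set Q) (v : List A)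
    (h : ∀ u : List A, u.length < v.length → (M.run (M.step p a) u ∈ T ↔ M.run e u ∈ T)) :
    {x | M.run x v ∈ T}.ncard = T.ncard := by
  classical
  induction v with
  | nil => rfl
  | cons c v ih =>
    have ih := ih fun u hu => h u (by simp only [List.length_cons]; omega)
    rw [← ih]
    obtain rfl | rfl := hab c
    -- The hypothesis for u = v makes the two correction terms equal, so they cancel.
    · have := ncard_preimage_of_bijOn_compl ha {x | M.run x v ∈ T}
      have hv := h v (by simp)
      simp only [Set.mem_ofPred_eq, hv] at this
      exact Nat.add_right_cancel this
    · exact Set.ncard_preimage_of_injective_subset_range (s := {x | M.run x v ∈ T}) hb.injective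
        (by rw [hb.surjective.range_eq]; exact Set.subset_univ _)

/-! ### Growth of the relations generated by a pair -/

/-- The equivalence relation generated by the images of the pair `(d, e)` under words shorter than
`l`. -/
def pairSetoid (M : Automaton Q A) (d e : Q) (l : ℕ) : Setoid Q :=
  Relation.EqvGen.setoid fun x y => ∃ v : List A, v.length < l ∧ x = M.run d v ∧ y = M.run e v

theorem pairSetoid_le {M : Automaton Q A} {d e : Q} {l : ℕ} {K : Setoid Q}
    (h : ∀ v : List A, v.length < l → K (M.run d v) (M.run e v)) : M.pairSetoid d e l ≤ K := by
  refine Setoid.eqvGen_le ?_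
  rintro x y ⟨v, hv, rfl, rfl⟩
  exact h v hv

theorem pairSetoid_run (M : Automaton Q A) (d e : Q) {l : ℕ} {v : List A} (hv : v.length < l) :
    M.pairSetoid d e l (M.run d v) (M.run e v) :=
  Relation.EqvGen.rel _ _ ⟨v, hv, rfl, rfl⟩

theorem pairSetoid_mono (M : Automaton Q A) (d e : Q) {k l : ℕ} (h : k ≤ l) :
    M.pairSetoid d e k ≤ M.pairSetoid d e l :=
  pairSetoid_le fun _ hv => M.pairSetoid_run d e (hv.trans_le h)

theorem pairSetoid_succ_step (M : Automaton Q A) (d e : Q) (l : ℕ) (c : A) {x y : Q}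
    (h : M.pairSetoid d e l x y) : M.pairSetoid d e (l + 1) (M.step x c) (M.step y c) := by
  have : M.pairSetoid d e l ≤ (M.pairSetoid d e (l + 1)).comap fun x => M.step x c := by
    refine pairSetoid_le fun v hv => ?_
    have := M.pairSetoid_run d e (l := l + 1) (v := v ++ [c]) (by simp; omega)
    simpa [run_append, Setoid.comap_rel] using this
  exact this h

theorem pairSetoid_of_stable {M : Automaton Q A} {d e : Q} {l : ℕ}
    (h : M.pairSetoid d e (l + 1) = M.pairSetoid d e l) (v : List A) :
    M.pairSetoid d e l (M.run d v) (M.run e v) := by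
  have hrun : ∀ (v : List A) (x y : Q), M.pairSetoid d e l x y →
      M.pairSetoid d e l (M.run x v) (M.run y v) := by
    intro v
    induction v with
    | nil => exact fun x y h => h
    | cons c v ih =>
      intro x y hxy
      refine ih _ _ ?_
      rw [← h]
      exact M.pairSetoid_succ_step d e l c hxy
  refine hrun v d e ?_
  rw [← h]
  exact M.pairSetoid_run d e (v := []) (by simp)

theorem _root_.Setoid.card_quotient_lt [Finite Q] {r s : Setoid Q} (h : r < s) :
    Nat.card (Quotient s) < Nat.card (Quotient r) := by
  have hsurj : Function.Surjective (Quotient.map' (s₁ := r) (s₂ := s) id fun _ _ hxy => h.le hxy) := by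
    intro y
    induction y using Quotient.inductionOn' with
    | h y => exact ⟨Quotient.mk'' y, rfl⟩
  refine lt_of_le_of_ne (Nat.card_le_card_of_surjective _ hsurj) fun hcard => h.not_ge ?_
  have hinj := ((Nat.bijective_iff_surjective_and_card _).2 ⟨hsurj, hcard.symm⟩).injective
  intro x y hxy
  exact Quotient.eq''.1 (hinj (a₁ := Quotient.mk'' x) (a₂ := Quotient.mk'' y)
    (Quotient.eq''.2 hxy))

/-- If `v` is a shortest word taking the pair `(d, e)` outside of an equivalence relation `K`, then
the length of `v` plus the number of classes of `K` is at most the number of states. -/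
theorem card_quotient_add_length_le [Finite Q] {M : Automaton Q A} {d e : Q} {K : Setoid Q}
    {v : List A} (hv : ¬ K (M.run d v) (M.run e v))
    (hmin : ∀ u : List A, u.length < v.length → K (M.run d u) (M.run e u)) :
    Nat.card (Quotient K) + v.length ≤ Nat.card Q := by
  have hcard : ∀ l ≤ v.length, Nat.card (Quotient (M.pairSetoid d e l)) + l ≤ Nat.card Q := by
    intro l
    induction l with
    | zero =>
      exact fun _ => Nat.card_le_card_of_surjective (Quotient.mk (M.pairSetoid d e 0))
        Quotient.mk_surjective
    | succ l ih =>
      intro hl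
      have hlt : M.pairSetoid d e l < M.pairSetoid d e (l + 1) := by
        -- A chain that pauses once is constant from then on, which would put the images under v in
        -- K.
        refine lt_of_le_of_ne (M.pairSetoid_mono d e l.le_succ) fun heq => hv ?_
        exact pairSetoid_le (fun u hu => hmin u (by omega)) (pairSetoid_of_stable heq.symm v)
      have := Setoid.card_quotient_lt hlt
      have := ih (by omega)
      omega
  have hle : M.pairSetoid d e v.length ≤ K := pairSetoid_le hmin
  have hK : Nat.card (Quotient K) ≤ Nat.card (Quotient (M.pairSetoid d e v.length)) := by
    rcases hle.lt_or_eq with h | h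
    · exact (Setoid.card_quotient_lt h).le
    · rw [h]
  have := hcard _ le_rfl
  omega

/-! ### Extending subsets when `b` is the cyclic shift -/

open scoped Pointwise in
/-- If `S` is not contained in its translate, some translate separates two given points whose
difference does not stabilize `S`. -/
theorem exists_add_mem_of_not_mem_stabilizer {n : ℕ} [NeZero n] {S : Set (ZMod n)} {y z : ZMod n}
    (h : -y + z ∉ AddAction.stabilizer (ZMod n) S) : ∃ i, y + i ∈ S ∧ z + i ∉ S := by
  by_contra! hcon
  refine h (AddAction.mem_stabilizer_iff.2 ?_)
  refine Set.eq_of_subset_of_ncard_le ?_ (by rw [Set.ncard_vadd_set])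
  rintro _ ⟨x, hx, rfl⟩
  have := hcon (x - y) (by simpa using hx)
  have h2 : z + (x - y) = (-y + z) +ᵥ x := by rw [vadd_eq_add]; ring
  rwa [h2] at this

theorem run_replicate {n : ℕ} {M : Automaton (ZMod n) A} {b : A} (hb : ∀ x, M.step x b = x + 1)
    (x : ZMod n) (i : ℕ) : M.run x (List.replicate i b) = x + i := by
  induction i generalizing x with
  | zero => simp
  | succ i ih => rw [List.replicate_succ, run_cons, ih, hb]; push_cast; ring

open scoped Pointwise in
theorem exists_length_le_ncard_lt {n : ℕ} [NeZero n] {M : Automaton (ZMod n) A} {a b : A}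
    (hab : ∀ c, c = a ∨ c = b) (hb : ∀ x, M.step x b = x + 1) {p e : ZMod n}
    (ha : Set.BijOn (fun x => M.step x a) {p}ᶜ {e}ᶜ) (hsync : M.IsSynchronizing)
    {S : Set (ZMod n)} (hne : S.Nonempty) (hS : S ≠ Set.univ) :
    ∃ w : List A, w.length ≤ n ∧ S.ncard < {x | M.run x w ∈ S}.ncard := by
  classical
  have hbij : Function.Bijective fun x => M.step x b := by
    simp only [hb]
    exact (Equiv.addRight (1 : ZMod n)).bijective
  set G := AddAction.stabilizer (ZMod n) S with hG
  have hGmem : ∀ {g : ZMod n}, g ∈ G → ∀ x, (x + g ∈ S ↔ x ∈ S) := by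
    intro g hg x
    have := Set.vadd_mem_vadd_set_iff (a := g) (s := S) (x := x)
    rwa [AddAction.mem_stabilizer_iff.1 hg, vadd_eq_add, add_comm] at this
  set K := QuotientAddGroup.leftRel G with hK
  have hKrel : ∀ x y, K x y ↔ -x + y ∈ G := fun x y => QuotientAddGroup.leftRel_apply
  have hKmem : ∀ {x y}, K x y → (x ∈ S ↔ y ∈ S) := by
    intro x y hxy
    have := hGmem ((hKrel x y).1 hxy) x
    rw [add_neg_cancel_left] at this
    exact this.symm
  set d := M.step p a with hd
  -- Otherwise every word preserves the size of S under preimage, whereas a reset word has preimage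
  -- ∅ or everything.
  have hex : ∃ v : List A, ¬ K (M.run d v) (M.run e v) := by
    by_contra! hcon
    obtain ⟨w, hw⟩ := hsync
    obtain ⟨q, hq⟩ := (M.isResetWord_iff w).1 hw
    have hcard := ncard_preimage_run hab hbij ha S w fun u _ => hKmem (hcon u)
    simp only [hq] at hcard
    by_cases hqS : q ∈ S
    · simp only [hqS, Set.ofPred_true] at hcard
      exact hS (Set.eq_of_subset_of_ncard_le (Set.subset_univ _) hcard.le)
    · simp only [hqS, Set.ofPred_false, Set.ncard_empty] at hcard
      exact hne.ne_empty ((Set.ncard_eq_zero).1 hcard.symm)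
  obtain ⟨v, hv, hmin⟩ := (measure (List.length (α := A))).wf.has_min
    {v | ¬ K (M.run d v) (M.run e v)} hex
  have hmin : ∀ u : List A, u.length < v.length → K (M.run d u) (M.run e u) := by
    intro u hu
    by_contra hcon
    exact hmin u hcon hu
  have hlen := card_quotient_add_length_le hv hmin
  rw [Nat.card_zmod] at hlen
  have hindex : Nat.card (Quotient K) = G.index := rfl
  rw [hindex] at hlen
  have hpos : 0 < G.index := Nat.pos_of_ne_zero AddSubgroup.index_ne_zero_of_finite
  -- The orientation matters: d must land inside S and e outside, so that `a` gains a state rather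
  -- than losing one.
  obtain ⟨i, hi, hi'⟩ := exists_add_mem_of_not_mem_stabilizer (S := S)
    (fun h => hv ((hKrel _ _).2 h))
  -- Multiples of the index lie in G and fix S, so the shift can be reduced modulo the index.
  set k := i.val % G.index with hk
  have hkG : i - (k : ZMod n) ∈ G := by
    have h1 : i = ((G.index * (i.val / G.index) + k : ℕ) : ZMod n) := by
      rw [hk, Nat.div_add_mod, ZMod.natCast_val, ZMod.cast_id]
    have h2 : i - (k : ZMod n) = G.index • ((i.val / G.index : ℕ) : ZMod n) := by
      rw [nsmul_eq_mul, sub_eq_iff_eq_add]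
      exact_mod_cast h1
    rw [h2]
    exact G.nsmul_index_mem _
  have hshift : ∀ x, (x + (k : ZMod n) ∈ S ↔ x + i ∈ S) := by
    intro x
    rw [← hGmem hkG (x + k), add_assoc, add_sub_cancel]
  set T : Set (ZMod n) := {x | x + (k : ZMod n) ∈ S} with hT
  have hTcard : T.ncard = S.ncard :=
    Set.ncard_preimage_of_injective_subset_range (f := fun x => x + (k : ZMod n))
      (add_left_injective _) fun x _ => ⟨x - k, sub_add_cancel _ _⟩
  -- T is also a union of cosets of G, so by minimality no shorter word separates d and e with
  -- respect to T.
  have hpre := ncard_preimage_run hab hbij ha T v fun u hu => by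
    have := hGmem ((hKrel _ _).1 (hmin u hu)) (M.run d u + k)
    rw [show M.run d u + (k : ZMod n) + (-M.run d u + M.run e u) = M.run e u + k by ring] at this
    exact this.symm
  have hext := ncard_preimage_of_bijOn_compl ha {x | M.run x v ∈ T}
  have hd' : M.run d v ∈ T := (hshift _).2 hi
  have he' : M.run e v ∉ T := fun h => hi' ((hshift _).1 h)
  simp only [Set.mem_ofPred_eq, he', if_false, ← hd, hd', if_true, hpre, hTcard] at hext
  -- The length is 1 + |v| + k ≤ 1 + (n − index) + (index − 1) = n.
  refine ⟨a :: (v ++ List.replicate k b), ?_, ?_⟩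
  · have : k < G.index := Nat.mod_lt _ hpos
    simp
    omega
  · have heq : {x | M.run x (a :: (v ++ List.replicate k b)) ∈ S} =
        (fun x => M.step x a) ⁻¹' {x | M.run x v ∈ T} := by
      ext x
      simp [run_append, run_replicate hb, hT]
    rw [heq]
    omega

/-- Each extension costs at most n letters and adds at least one state; m bounds the number of
states still missing. -/
theorem exists_run_mem_of_two_le_ncard {n : ℕ} [NeZero n] {M : Automaton (ZMod n) A} {a b : A}
    (hab : ∀ c, c = a ∨ c = b) (hb : ∀ x, M.step x b = x + 1) {p e : ZMod n}
    (ha : Set.BijOn (fun x => M.step x a) {p}ᶜ {e}ᶜ) (hsync : M.IsSynchronizing) (m : ℕ)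
    {S : Set (ZMod n)} (hne : S.Nonempty) (hm : n ≤ S.ncard + m) :
    ∃ w : List A, w.length ≤ n * m ∧ ∀ x, M.run x w ∈ S := by
  have huniv : ∀ T : Set (ZMod n), n ≤ T.ncard → T = Set.univ := by
    intro T hT
    refine Set.eq_of_subset_of_ncard_le (Set.subset_univ _) ?_
    rwa [Set.ncard_univ, Nat.card_zmod]
  induction m generalizing S with
  | zero => exact ⟨[], by simp, fun x => by rw [huniv S (by omega)]; trivial⟩
  | succ m ih =>
    by_cases hS : S = Set.univ
    · exact ⟨[], by simp, fun x => by rw [hS]; trivial⟩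
    · obtain ⟨w, hw, hlt⟩ := exists_length_le_ncard_lt hab hb ha hsync hne hS
      obtain ⟨u, hu, hu'⟩ := ih (S := {x | M.run x w ∈ S})
        (Set.nonempty_of_ncard_ne_zero (by omega)) (by omega)
      refine ⟨u ++ w, ?_, fun x => by rw [run_append]; exact hu' x⟩
      rw [List.length_append, Nat.mul_succ]
      omega

theorem exists_isResetWord_of_circular {n : ℕ} [NeZero n] {M : Automaton (ZMod n) A} {a b : A}
    (hab : ∀ c, c = a ∨ c = b) (hb : ∀ x, M.step x b = x + 1) {p e : ZMod n}
    (ha : Set.BijOn (fun x => M.step x a) {p}ᶜ {e}ᶜ) (hpe : M.step p a ≠ e)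
    (hsync : M.IsSynchronizing) :
    ∃ w : List A, M.IsResetWord w ∧ w.length ≤ (n - 1) ^ 2 := by
  classical
  have hcard := ncard_preimage_of_bijOn_compl ha {M.step p a}
  simp only [Set.mem_singleton_iff, hpe.symm, if_false, if_true, Set.ncard_singleton] at hcard
  have hn : 2 ≤ n := by
    have := Set.ncard_le_card ((fun x => M.step x a) ⁻¹' {M.step p a})
    rw [Nat.card_zmod] at this
    omega
  obtain ⟨w, hw, hrun⟩ := exists_run_mem_of_two_le_ncard hab hb ha hsync (n - 2)
    (S := (fun x => M.step x a) ⁻¹' {M.step p a}) ⟨p, rfl⟩ (by omega)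
  refine ⟨w ++ [a], (M.isResetWord_iff _).2 ⟨M.step p a, fun x => ?_⟩, ?_⟩
  · rw [run_append]
    exact hrun x
  · obtain ⟨k, rfl⟩ := Nat.exists_eq_add_of_le hn
    rw [show 2 + k - 2 = k by omega] at hw
    rw [show 2 + k - 1 = k + 1 by omega, List.length_append, List.length_singleton]
    nlinarith

/-! ### Reduction of two-letter automata to the cyclic case -/

/-- A permutation of a finite set all of whose points lie in the forward orbit of one point is
conjugate to the successor map on residues. -/
theorem exists_equiv_zmod [Finite Q] [Nonempty Q] (β : Equiv.Perm Q) (e : Q)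
    (h : ∀ q, ∃ j : ℕ, (β ^ j) e = q) :
    ∃ φ : ZMod (Nat.card Q) ≃ Q, ∀ i, φ (i + 1) = β (φ i) := by
  classical
  have := Fintype.ofFinite Q
  have : NeZero (Nat.card Q) := ⟨Nat.card_pos.ne'⟩
  have hsame : ∀ q, β.SameCycle e q := fun q => by
    obtain ⟨j, hj⟩ := h q
    exact ⟨j, by simpa using hj⟩
  have hcyc : β.IsCycleOn ((Finset.univ : Finset Q) : Set Q) := by
    rw [Finset.coe_univ]
    exact ⟨Set.bijOn_univ.2 β.bijective, fun x _ y _ => (hsame x).symm.trans (hsame y)⟩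
  have hpow : (β ^ Nat.card Q) e = e := by
    have := hcyc.pow_card_apply (Finset.mem_univ e)
    rwa [Finset.card_univ, ← Nat.card_eq_fintype_card] at this
  have hmod : ∀ k : ℕ, (β ^ (k : ZMod (Nat.card Q)).val) e = (β ^ k) e := by
    intro k
    have hfix : ∀ m : ℕ, ((β ^ Nat.card Q) ^ m) e = e := fun m => by
      induction m with
      | zero => rfl
      | succ m ih => rw [pow_succ, Equiv.Perm.mul_apply, hpow, ih]
    rw [ZMod.val_natCast]
    conv_rhs => rw [← Nat.mod_add_div k (Nat.card Q), pow_add, pow_mul, Equiv.Perm.mul_apply, hfix]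
  have hsurj : Function.Surjective fun i : ZMod (Nat.card Q) => (β ^ i.val) e := by
    intro q
    obtain ⟨j, rfl⟩ := h q
    exact ⟨j, hmod j⟩
  refine ⟨Equiv.ofBijective _ ((Nat.bijective_iff_surjective_and_card _).2
    ⟨hsurj, Nat.card_zmod _⟩), fun i => ?_⟩
  have := hmod (i.val + 1)
  rw [Nat.cast_add, ZMod.natCast_val, ZMod.cast_id, Nat.cast_one, pow_succ',
    Equiv.Perm.mul_apply] at this
  exact this

/-- The automaton obtained by renaming the states. -/
def congrStates {R : Type*} (M : Automaton Q A) (φ : R ≃ Q) : Automaton R A where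
  step x c := φ.symm (M.step (φ x) c)

theorem run_congrStates {R : Type*} (M : Automaton Q A) (φ : R ≃ Q) (x : R) (w : List A) :
    φ ((M.congrStates φ).run x w) = M.run (φ x) w := by
  induction w generalizing x with
  | nil => rfl
  | cons c w ih => rw [run_cons, ih, run_cons, congrStates, φ.apply_symm_apply]

theorem isResetWord_congrStates {R : Type*} [Nonempty Q] [Nonempty R] (M : Automaton Q A)
    (φ : R ≃ Q) (w : List A) : (M.congrStates φ).IsResetWord w ↔ M.IsResetWord w := by
  rw [isResetWord_iff, isResetWord_iff]
  constructor
  · rintro ⟨q, hq⟩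
    refine ⟨φ q, fun x => ?_⟩
    rw [← hq (φ.symm x), run_congrStates, φ.apply_symm_apply]
  · rintro ⟨q, hq⟩
    refine ⟨φ.symm q, fun x => ?_⟩
    rw [← hq (φ x), ← run_congrStates, φ.symm_apply_apply]

/-- If `b` acts as a permutation, the image of any word is the whole state set or lies in the image
of `a` followed by a power of `b`. -/
theorem image_eq_univ_or_subset {M : Automaton Q A} {a b : A} (hab : ∀ c, c = a ∨ c = b)
    {β : Equiv.Perm Q} (hβ : ∀ x, M.step x b = β x) (w : List A) :
    M.image w = Set.univ ∨
      ∃ j : ℕ, M.image w ⊆ (β ^ j) '' Set.range fun x => M.step x a := by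
  induction w using List.reverseRecOn with
  | nil => exact Or.inl Set.range_id
  | append_singleton w c ih =>
    rw [image_append]
    obtain rfl | rfl := hab c
    · refine Or.inr ⟨0, ?_⟩
      rintro _ ⟨x, -, rfl⟩
      exact ⟨_, ⟨x, rfl⟩, rfl⟩
    · have hc : (fun q => M.run q [c]) = β := funext hβ
      rw [hc]
      rcases ih with h | ⟨j, h⟩
      · exact Or.inl (by rw [h, Set.image_univ, β.surjective.range_eq])
      · refine Or.inr ⟨j + 1, (Set.image_mono h).trans ?_⟩
        rw [← Set.image_comp, pow_succ']
        rfl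

theorem image_eq_univ_of_surjective {M : Automaton Q A}
    (h : ∀ c, Function.Surjective fun x => M.step x c) (w : List A) : M.image w = Set.univ := by
  induction w using List.reverseRecOn with
  | nil => exact Set.range_id
  | append_singleton w c ih =>
    rw [image_append, ih, Set.image_univ]
    exact (h c).range_eq

theorem _root_.Set.BijOn.exists_of_range_eq_compl_singleton [Finite Q] {f : Q → Q} {e : Q}
    (h : Set.range f = {e}ᶜ) : ∃ p, Set.BijOn f {p}ᶜ {e}ᶜ ∧ f p ≠ e := by
  have hne : ∀ x, f x ≠ e := fun x => by
    have : f x ∈ Set.range f := ⟨x, rfl⟩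
    rwa [h] at this
  have hinj : ¬ Function.Injective f := fun hi => by
    obtain ⟨x, hx⟩ := Finite.surjective_of_injective hi e
    exact hne x hx
  obtain ⟨p, q, hpq, hp⟩ := Function.not_injective_iff.1 hinj
  have himage : f '' {p}ᶜ = {e}ᶜ := by
    rw [← h]
    refine Set.Subset.antisymm (Set.image_subset_range _ _) ?_
    rintro _ ⟨x, rfl⟩
    by_cases hx : x = p
    · exact ⟨q, hp.symm, by rw [hx, hpq]⟩
    · exact ⟨x, hx, rfl⟩
  refine ⟨p, ⟨fun x _ => hne x, Set.injOn_of_ncard_image_eq ?_, himage.ge⟩, hne p⟩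
  rw [himage, Set.ncard_compl, Set.ncard_compl, Set.ncard_singleton, Set.ncard_singleton]

/-- If no letter is surjective, the last letter of a word reaching Q∖{q} must have exactly this
image, so distinct q need distinct letters. -/
theorem CompletelyReachable.exists_surjective_step [Finite Q] [Finite A] {M : Automaton Q A}
    (h : M.CompletelyReachable) (hA : Nat.card A < Nat.card Q) (hQ : 2 ≤ Nat.card Q) :
    ∃ b, Function.Surjective fun x => M.step x b := by
  by_contra! hcon
  have : Nontrivial Q := Finite.one_lt_card_iff_nontrivial.1 hQ
  have hlast : ∀ q : Q, ∃ c : A, Set.range (fun x => M.step x c) = {q}ᶜ := by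
    intro q
    obtain ⟨w, hw⟩ := h {q}ᶜ (Set.nonempty_compl_of_nontrivial q)
    rcases w.eq_nil_or_concat' with rfl | ⟨w, c, rfl⟩
    · have : q ∈ ({q}ᶜ : Set Q) := by rw [hw]; exact ⟨q, rfl⟩
      exact absurd rfl this
    · refine ⟨c, Set.Subset.antisymm ?_ ?_⟩
      · intro y hy hyq
        rw [Set.mem_singleton_iff] at hyq
        subst hyq
        refine hcon c fun z => ?_
        by_cases hz : z = y
        · rw [hz]
          exact hy
        · have hz' : z ∈ ({y}ᶜ : Set Q) := hz
          rw [hw, image_append] at hz'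
          obtain ⟨x, -, hx⟩ := hz'
          exact ⟨x, hx⟩
      · rw [hw, image_append]
        rintro _ ⟨x, -, rfl⟩
        exact ⟨x, rfl⟩
  choose f hf using hlast
  refine hA.not_ge (Nat.card_le_card_of_injective f fun x y hxy => ?_)
  have := hf x
  rw [hxy, hf y] at this
  exact (Set.singleton_injective (compl_injective this)).symm

theorem CompletelyReachable.exists_not_surjective_step [Nontrivial Q] {M : Automaton Q A}
    (h : M.CompletelyReachable) : ∃ a, ¬ Function.Surjective fun x => M.step x a := by
  by_contra! hcon
  obtain ⟨q⟩ := (inferInstance : Nonempty Q)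
  obtain ⟨w, hw⟩ := h {q} ⟨q, rfl⟩
  rw [image_eq_univ_of_surjective hcon] at hw
  obtain ⟨x, hx⟩ := exists_ne q
  have : x ∈ ({q} : Set Q) := by rw [hw]; trivial
  exact hx this

/-- In a completely reachable automaton with two letters and at least three states, one letter is a
cyclic permutation and the other one misses exactly one state. -/
theorem CompletelyReachable.exists_circular [Finite Q] {M : Automaton Q A}
    (h : M.CompletelyReachable) (hA : Nat.card A = 2) (hQ : 3 ≤ Nat.card Q) :
    ∃ (a b : A) (β : Equiv.Perm Q) (e : Q), (∀ c, c = a ∨ c = b) ∧ (∀ x, M.step x b = β x) ∧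
      Set.range (fun x => M.step x a) = {e}ᶜ ∧ ∀ q, ∃ j : ℕ, (β ^ j) e = q := by
  have : Finite A := Nat.finite_of_card_ne_zero (by omega)
  have : Nontrivial Q := Finite.one_lt_card_iff_nontrivial.1 (by omega)
  obtain ⟨b, hb⟩ := h.exists_surjective_step (by omega) (by omega)
  obtain ⟨a, ha⟩ := h.exists_not_surjective_step
  have hne : a ≠ b := fun hab => ha (hab ▸ hb)
  have hab : ∀ c, c = a ∨ c = b := by
    intro c
    by_contra! hcon
    have hinj : Function.Injective ![a, b, c] := by
      intro i j hij
      fin_cases i <;> fin_cases j <;> simp_all [eq_comm]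
    have := Nat.card_le_card_of_injective _ hinj
    rw [Nat.card_fin] at this
    omega
  set β : Equiv.Perm Q := Equiv.ofBijective _ ⟨Finite.injective_iff_surjective.2 hb, hb⟩ with hβ
  have hstep : ∀ x, M.step x b = β x := fun x => rfl
  have hmiss : ∀ q, ∃ j : ℕ, ∀ y ≠ q, y ∈ (β ^ j) '' Set.range fun x => M.step x a := by
    intro q
    obtain ⟨w, hw⟩ := h {q}ᶜ (Set.nonempty_compl_of_nontrivial q)
    rcases image_eq_univ_or_subset hab hstep w with h1 | ⟨j, hj⟩
    · rw [h1] at hw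
      have : q ∈ ({q}ᶜ : Set Q) := by rw [hw]; trivial
      exact absurd rfl this
    · rw [← hw] at hj
      exact ⟨j, fun y hy => hj hy⟩
  obtain ⟨e, he⟩ := not_forall.1 ha
  have horbit : ∀ e, e ∉ Set.range (fun x => M.step x a) → ∀ q, ∃ j : ℕ, (β ^ j) e = q ∧
      ∀ y ≠ q, y ∈ (β ^ j) '' Set.range fun x => M.step x a := by
    intro e he q
    obtain ⟨j, hj⟩ := hmiss q
    refine ⟨j, ?_, hj⟩
    -- As e is not in the image of `a`, the state b^j e is not in the shifted image, which contains
    -- everything but q.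
    by_contra hcon
    obtain ⟨y, hy, hye⟩ := hj _ hcon
    rw [(β ^ j).injective hye] at hy
    exact he hy
  refine ⟨a, b, β, e, hab, hstep, Set.Subset.antisymm ?_ ?_,
    fun q => (horbit e he q).imp fun j hj => hj.1⟩
  · rintro y hy rfl
    exact he hy
  · intro z hz
    -- Taking q = e gives a power fixing e, so undoing it shows that the image of `a` itself misses
    -- only e.
    obtain ⟨j, hj, hj'⟩ := horbit e he e
    obtain ⟨y, hy, hyz⟩ := hj' ((β ^ j) z) fun hcon => hz ((β ^ j).injective (hcon.trans hj.symm))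
    rwa [(β ^ j).injective hyz] at hy

theorem CompletelyReachable.exists_isResetWord [Finite Q] [Nonempty Q] {M : Automaton Q A}
    (h : M.CompletelyReachable) (hA : Nat.card A = 2) :
    ∃ w : List A, M.IsResetWord w ∧ w.length ≤ (Nat.card Q - 1) ^ 2 := by
  rcases subsingleton_or_nontrivial Q with hQ | hQ
  · obtain ⟨q⟩ := ‹Nonempty Q›
    exact ⟨[], (M.isResetWord_iff _).2 ⟨q, fun x => Subsingleton.elim _ _⟩, Nat.zero_le _⟩
  -- Two states are separate because `exists_surjective_step` needs fewer letters than states; there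
  -- the non-surjective letter already resets.
  rcases eq_or_lt_of_le (Nat.succ_le_of_lt (Finite.one_lt_card_iff_nontrivial.2 hQ)) with h2 | h3
  · obtain ⟨a, ha⟩ := h.exists_not_surjective_step
    refine ⟨[a], ?_, by rw [← h2]; simp⟩
    have hlt : (M.image [a]).ncard < 2 := by
      refine lt_of_lt_of_eq ?_ h2.symm
      exact Set.ncard_lt_card fun huniv => ha (Set.range_eq_univ.1 huniv)
    have hpos : 0 < (M.image [a]).ncard := (Set.ncard_pos).2 (Set.range_nonempty _)
    exact Set.ncard_eq_one.1 (by omega)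
  · obtain ⟨a, b, β, e, hab, hb, ha, he⟩ := h.exists_circular hA h3
    obtain ⟨φ, hφ⟩ := exists_equiv_zmod β e he
    have : NeZero (Nat.card Q) := ⟨Nat.card_pos.ne'⟩
    have hrange : Set.range (fun x => (M.congrStates φ).step x a) = {φ.symm e}ᶜ := by
      have : (fun x => (M.congrStates φ).step x a) = φ.symm ∘ (fun x => M.step x a) ∘ φ := rfl
      rw [this, Set.range_comp, φ.surjective.range_comp, ha, φ.symm.image_compl,
        Set.image_singleton]
    obtain ⟨p, hp, hpe⟩ := Set.BijOn.exists_of_range_eq_compl_singleton hrange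
    obtain ⟨u, hu⟩ := h.isSynchronizing
    obtain ⟨w, hw, hlen⟩ := exists_isResetWord_of_circular (M := M.congrStates φ) hab
      (fun x => by
        change φ.symm (M.step (φ x) b) = x + 1
        rw [hb, ← hφ, φ.symm_apply_apply]) hp hpe ⟨u, (M.isResetWord_congrStates φ u).2 hu⟩
    exact ⟨w, (M.isResetWord_congrStates φ w).1 hw, hlen⟩

end Automaton

/-! ### The Černý automaton: complete reachability -/

section Cerny

open Automaton

theorem cernyAutomaton_step_a {n : ℕ} (x : ZMod n) :
    (cernyAutomaton n).step x .a = if x = 0 then 1 else x := rfl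

theorem cernyAutomaton_step_b {n : ℕ} (x : ZMod n) :
    (cernyAutomaton n).step x .b = x + 1 := rfl

theorem cernyAutomaton_completelyReachable {n : ℕ} (hn : 1 < n) :
    (cernyAutomaton n).CompletelyReachable := by
  have : NeZero n := ⟨by omega⟩
  have : Fact (1 < n) := ⟨hn⟩
  -- Induction on a bound m for the number of states missing from S.
  suffices H : ∀ (m : ℕ) (S : Set (ZMod n)), S.Nonempty → n ≤ S.ncard + m →
      (cernyAutomaton n).IsReachable S from fun S hS => H n S hS (by omega)
  intro m
  induction m with
  | zero =>
    intro S _ hS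
    refine ⟨[], (Set.eq_of_subset_of_ncard_le (Set.subset_univ _) ?_).trans Set.range_id.symm⟩
    rwa [Set.ncard_univ, Nat.card_zmod]
  | succ m ih =>
    intro S hne hS
    by_cases hex : ∃ j : ZMod n, j ∉ S ∧ j + 1 ∈ S
    · obtain ⟨j, hj, hj'⟩ := hex
      have hcard : {x | x + j ∈ S}.ncard = S.ncard :=
        Set.ncard_preimage_of_injective_subset_range (f := fun x => x + j)
          (add_left_injective _) fun x _ => ⟨x - j, sub_add_cancel _ _⟩
      have h0 : (0 : ZMod n) ∉ {x | x + j ∈ S} := by simpa using hj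
      -- The shifted set S − j omits 0 and contains 1, so adding 0 gives a larger set that `a` maps
      -- onto S − j.
      obtain ⟨w, hw⟩ := ih (insert 0 {x | x + j ∈ S}) ⟨0, Set.mem_insert _ _⟩
        (by rw [Set.ncard_insert_of_notMem h0, hcard]; omega)
      refine ⟨w ++ .a :: List.replicate j.val .b, ?_⟩
      rw [image_append, ← hw]
      have hrun : ∀ x, (cernyAutomaton n).run x (.a :: List.replicate j.val .b) =
          (if x = 0 then 1 else x) + j := fun x => by
        rw [run_cons, run_replicate cernyAutomaton_step_b, ZMod.natCast_val, ZMod.cast_id,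
          cernyAutomaton_step_a]
      simp only [hrun]
      ext y
      constructor
      · intro hy
        by_cases hyj : y = j + 1
        · exact ⟨0, Set.mem_insert _ _, by simp [hyj, add_comm]⟩
        · have hy0 : y - j ≠ 0 := fun h0 => hj (by rwa [← sub_eq_zero.1 h0])
          exact ⟨y - j, Set.mem_insert_of_mem _ (by simpa using hy), by simp [hy0]⟩
      · rintro ⟨x, hx, rfl⟩
        dsimp only
        split_ifs with h
        · rwa [add_comm]
        · exact hx.resolve_left h
    · push Not at hex
      obtain ⟨s, hs⟩ := hne
      have hall : ∀ k : ℕ, s - k ∈ S := by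
        intro k
        induction k with
        | zero => simpa using hs
        | succ k ihk =>
          by_contra hcon
          refine hex _ hcon ?_
          rwa [Nat.cast_succ, sub_add_eq_sub_sub, sub_add_cancel]
      refine ⟨[], Eq.trans (Set.eq_univ_of_forall fun x => ?_) Set.range_id.symm⟩
      have := hall (s - x).val
      rwa [ZMod.natCast_val, ZMod.cast_id, sub_sub_cancel] at this

/-! ### The Černý automaton: lower bound -/

/-- The number of times the letter `a` moves the current state when the Černý automaton reads a
word from a given state. -/
def cernyMoves {n : ℕ} : ZMod n → List BinaryLetter → ℕ
  | _, [] => 0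
  | x, .a :: w => if x = 0 then cernyMoves (1 : ZMod n) w + 1 else cernyMoves x w
  | x, .b :: w => cernyMoves (x + 1) w

/-- The number of occurrences of the letter `b`. -/
def countB : List BinaryLetter → ℕ
  | [] => 0
  | .a :: w => countB w
  | .b :: w => countB w + 1

theorem cernyAutomaton_run_eq {n : ℕ} (x : ZMod n) (w : List BinaryLetter) :
    (cernyAutomaton n).run x w = x + cernyMoves x w + countB w := by
  induction w generalizing x with
  | nil => simp [cernyMoves, countB]
  | cons c w ih =>
    rw [run_cons, ih]
    cases c with
    | a =>
      rw [cernyAutomaton_step_a, cernyMoves, countB]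
      split_ifs with h
      · rw [h]; push_cast; ring
      · rfl
    | b =>
      rw [cernyAutomaton_step_b, cernyMoves, countB]
      push_cast
      ring

/-- Between two consecutive moves of a state, the letter `b` has to be read `n - 1` times. -/
theorem cernyMoves_mul_add_val_le {n : ℕ} [NeZero n] (x : ZMod n) (w : List BinaryLetter) :
    cernyMoves x w * n + (-x).val ≤ w.length + (n - 1) := by
  have hpos : 0 < n := NeZero.pos n
  induction w generalizing x with
  | nil =>
    have := ZMod.val_lt (-x)
    simp only [cernyMoves, List.length_nil]
    omega
  | cons c w ih =>
    rw [List.length_cons]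
    cases c with
    | a =>
      rw [cernyMoves]
      split_ifs with h
      · have h1 := ih 1
        have h2 : (-1 : ZMod n).val = n - 1 := by
          obtain ⟨k, rfl⟩ := Nat.exists_eq_succ_of_ne_zero hpos.ne'
          exact ZMod.val_neg_one k
        rw [h, neg_zero, ZMod.val_zero, Nat.succ_mul]
        omega
      · have := ih x
        omega
    | b =>
      rw [cernyMoves]
      have h1 := ih (x + 1)
      have h2 : (-x).val ≤ (-(x + 1)).val + 1 := by
        have h3 : -x = (((-(x + 1)).val + 1 : ℕ) : ZMod n) := by
          rw [Nat.cast_add, ZMod.natCast_val, ZMod.cast_id]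
          push_cast
          ring
        conv_lhs => rw [h3]
        rw [ZMod.val_natCast]
        exact Nat.mod_le _ _
      omega

/-- For a reset word, x plus its number of moves is constant modulo n. If all counts were below n −
1, the congruence between x and x + 1 would be an equality, so the count would drop from x to x + 1,
impossible at a minimum. -/
theorem exists_le_cernyMoves {n : ℕ} (hn : 1 < n) {w : List BinaryLetter}
    (hw : (cernyAutomaton n).IsResetWord w) : ∃ x : ZMod n, n - 1 ≤ cernyMoves x w := by
  have : NeZero n := ⟨by omega⟩
  obtain ⟨q, hq⟩ := (isResetWord_iff _ w).1 hw
  by_contra! hcon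
  obtain ⟨x, hx⟩ := Finite.exists_min fun x : ZMod n => cernyMoves x w
  have hcast : ((cernyMoves x w : ℕ) : ZMod n) = ((cernyMoves (x + 1) w + 1 : ℕ) : ZMod n) := by
    have h1 := (hq x).trans (hq (x + 1)).symm
    rw [cernyAutomaton_run_eq, cernyAutomaton_run_eq] at h1
    push_cast
    linear_combination h1
  rw [ZMod.natCast_eq_natCast_iff] at hcast
  have h1 := hcon x
  have h2 := hcon (x + 1)
  have := Nat.ModEq.eq_of_lt_of_lt hcast (by omega) (by omega)
  have := hx (x + 1)
  omega

theorem le_length_of_isResetWord_cernyAutomaton {n : ℕ} (hn : 1 < n) {w : List BinaryLetter}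
    (hw : (cernyAutomaton n).IsResetWord w) : (n - 1) ^ 2 ≤ w.length := by
  have : NeZero n := ⟨by omega⟩
  obtain ⟨x, hx⟩ := exists_le_cernyMoves hn hw
  have h1 := cernyMoves_mul_add_val_le x w
  have h2 := Nat.mul_le_mul_right n hx
  obtain ⟨k, rfl⟩ := Nat.exists_eq_add_of_lt hn
  rw [show 1 + k + 1 - 1 = k + 1 by omega] at *
  nlinarith

theorem card_binaryLetter : Nat.card BinaryLetter = 2 := by
  refine Nat.card_eq_two_iff.2 ⟨.a, .b, nofun, ?_⟩
  ext c
  cases c <;> simp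

end Cerny

theorem proposition3 :
    (∀ (Q A : Type*) [Finite Q] [Nonempty Q] (_ : Nat.card A = 2) (M : Automaton Q A),
      M.CompletelyReachable →
        M.IsSynchronizing ∧ M.resetThreshold ≤ (Nat.card Q - 1) ^ 2) ∧
    (∀ n : ℕ, 1 < n →
      (cernyAutomaton n).CompletelyReachable ∧
        (cernyAutomaton n).IsSynchronizing ∧
        (cernyAutomaton n).resetThreshold = (n - 1) ^ 2) := by
  refine ⟨fun Q A _ _ hA M hM => ?_, fun n hn => ?_⟩
  · obtain ⟨w, hw, hlen⟩ := hM.exists_isResetWord hA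
    exact ⟨⟨w, hw⟩, (M.resetThreshold_le hw).trans hlen⟩
  · have : NeZero n := ⟨by omega⟩
    have hcr := cernyAutomaton_completelyReachable hn
    obtain ⟨w, hw, hlen⟩ := hcr.exists_isResetWord card_binaryLetter
    rw [Nat.card_zmod] at hlen
    refine ⟨hcr, ⟨w, hw⟩,
      (((cernyAutomaton n).resetThreshold_le hw).trans hlen).antisymm ?_⟩
    refine le_csInf ⟨_, w, hw, rfl⟩ ?_
    rintro _ ⟨u, hu, rfl⟩
    exact le_length_of_isResetWord_cernyAutomaton hn hu
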